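/- Let $N\ge 1$ and let $W:[0,\infty)\to(-\infty,\infty]$ be a lower-semicontinuous function such that $w(x):=W(|x|)$ is locally integrable on $\mathbb{R}^N$ and $W(r)\to 0$ as $r\to\infty$. For a Borel probability measure $\mu$ on $\mathbb{R}^N$ let $$E(\mu)=\int_{\mathbb{R}^N}\int_{\mathbb{R}^N} W(|x-y|)\,d\mu(x)\,d\mu(y)\in(-\infty,\infty].$$ Then $E$ has a global minimizer in the set $\mathcal{P}(\mathbb{R}^N)$ of Borel probability measures on $\mathbb{R}^N$ (that is, there is $\mu_0\in\mathcal{P}(\mathbb{R}^N)$ with $E(\mu_0)\le E(\mu)$ for all $\mu\in\mathcal{P}(\mathbb{R}^N)$) if and only if there exists $\bar\mu\in\mathcal{P}(\mathbb{R}^N)$ with $E(\bar\mu)\le 0$. -/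

import Mathlib

open MeasureTheory Filter Topology
open scoped NNReal ENNReal

noncomputable section

/-- The radial potential `w x = W |x|` on `ℝ^N` with profile `W : [0, ∞) → [-∞, ∞]`. -/
def radialPotential {N : ℕ} (W : ℝ≥0 → EReal) (x : EuclideanSpace ℝ (Fin N)) : EReal :=
  W ‖x‖₊

/-- The integral `∫ f⁺ dμ - ∫ f⁻ dμ` of an extended-real-valued function. It is the usual integral
whenever one of the two terms is finite; the second one is, for instance, when `f` is bounded
below by a real number and `μ` is finite. -/
def erealIntegral {α : Type*} [MeasurableSpace α] (f : α → EReal) (μ : Measure α) : EReal :=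
  ((∫⁻ x, (f x).toENNReal ∂μ : ℝ≥0∞) : EReal) - ((∫⁻ x, (-f x).toENNReal ∂μ : ℝ≥0∞) : EReal)

/-- The nonlocal interaction energy `E(μ) = ∬ w (x - y) dμ(x) dμ(y)` of a probability measure on
`ℝ^N`, as an integral over the product measure `μ × μ`. -/
def interactionEnergy {N : ℕ} (W : ℝ≥0 → EReal)
    (μ : ProbabilityMeasure (EuclideanSpace ℝ (Fin N))) : EReal :=
  erealIntegral (fun p : EuclideanSpace ℝ (Fin N) × EuclideanSpace ℝ (Fin N) =>
    radialPotential W (p.1 - p.2))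
    ((μ : Measure (EuclideanSpace ℝ (Fin N))).prod (μ : Measure (EuclideanSpace ℝ (Fin N))))

/-- Local integrability, for Lebesgue measure, of an extended-real-valued function on `ℝ^N`: it is
finite almost everywhere, and its real-valued version is locally integrable. -/
def ERealLocallyIntegrable {N : ℕ} (f : EuclideanSpace ℝ (Fin N) → EReal) : Prop :=
  (∀ᵐ x ∂(volume : Measure (EuclideanSpace ℝ (Fin N))), f x ≠ ⊤ ∧ f x ≠ ⊥) ∧
    LocallyIntegrable (fun x => (f x).toReal) (volume : Measure (EuclideanSpace ℝ (Fin N)))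

end

/-!
Let `-M` be a lower bound of `W` and put `g = w + M ≥ 0`. For probability measures
`E(μ) = F(μ) - M` with `F(μ) = ∬ g (x - y) dμ dμ` in `[0, ∞]`
(`interactionEnergy_eq_mutualEnergy_sub`), `g` tends to `M` at infinity, and `0` becomes the level
`M` for `F`.

Uniform measures on large balls have energy arbitrarily close to `M`, or below, since `g` is
integrable near the origin and close to `M` far away
(`exists_mutualEnergy_le_of_tendsto_cocompact`). So a minimizer has `F ≤ M`.

Conversely, let `F(μ₁) ≤ M`. If `F ≥ M` everywhere, `μ₁` is a minimizer. Otherwise `J = inf F < M`,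
and `g ≥ c` outside a ball of radius `L` for some `J < c < M`. Any measure of energy at most some
`e < c` gives a mass `≥ m > 0` to some ball of radius `L` (`exists_measure_ball_ge`), with `m`
independent of the measure. Around this ball there is a gap of width `L` and tiny mass
(pigeonhole over annuli); if `θ` and `b` are the masses inside and outside the gap, then by
homogeneity `F(μ) ≥ J θ² + J b² + 2 c θ b`. As `θ + b` is almost `1`, `θ ≥ m` and `c > J`, this
makes `b` small when `F(μ)` is close to `J` (`exists_measure_compl_ball_le`). Hence translates of a
minimizing sequence are tight, Prokhorov's theorem gives a weak limit, and `F` is lower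
semicontinuous under weak convergence because `g` is lower semicontinuous
(`mutualEnergy_le_liminf`); the limit is a minimizer.
-/

/-! ### Mutual energies and concentration of almost-minimizers -/

section MutualEnergy

open Metric Set

variable {E : Type*} [NormedAddCommGroup E] [MeasurableSpace E]

/-- The mutual interaction energy `∬ g (x - y) dμ(x) dν(y)` of two measures, for a kernel with
values in `[0, ∞]`. -/
noncomputable def mutualEnergy (g : E → ℝ≥0∞) (μ ν : Measure E) : ℝ≥0∞ :=
  ∫⁻ p, g (p.1 - p.2) ∂(μ.prod ν)

variable [BorelSpace E] [ProperSpace E] {g : E → ℝ≥0∞}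

lemma mutualEnergy_eq_iterated (hg : Measurable g) (μ ν : Measure E) [SFinite μ] [SFinite ν] :
    mutualEnergy g μ ν = ∫⁻ x, ∫⁻ y, g (x - y) ∂ν ∂μ :=
  lintegral_prod _ (hg.comp measurable_sub).aemeasurable

lemma mutualEnergy_smul_smul (a : ℝ≥0∞) (μ : Measure E) [SFinite μ] (hg : Measurable g) :
    mutualEnergy g (a • μ) (a • μ) = a ^ 2 * mutualEnergy g μ μ := by
  rw [mutualEnergy_eq_iterated hg, mutualEnergy_eq_iterated hg, lintegral_smul_measure]
  simp_rw [lintegral_smul_measure, smul_eq_mul]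
  rw [lintegral_const_mul, sq, mul_assoc]
  exact (hg.comp measurable_sub).lintegral_prod_right'

lemma mutualEnergy_map_sub_const (hg : Measurable g) (μ : Measure E) [SFinite μ] (a : E) :
    mutualEnergy g (μ.map (· - a)) (μ.map (· - a)) = mutualEnergy g μ μ := by
  have hm : Measurable (fun x : E => x - a) := measurable_id.sub_const a
  have hg' : Measurable fun p : E × E => g (p.1 - p.2) := hg.comp measurable_sub
  unfold mutualEnergy
  rw [Measure.map_prod_map _ _ hm hm, lintegral_map hg' (hm.prodMap hm)]
  simp

/-- A lower bound for the energy of probability measures extends to all finite measures by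
homogeneity. -/
lemma mul_sq_measure_univ_le_mutualEnergy (hg : Measurable g) {J : ℝ≥0∞}
    (hJ : ∀ μ : Measure E, IsProbabilityMeasure μ → J ≤ mutualEnergy g μ μ)
    (ν : Measure E) [IsFiniteMeasure ν] :
    J * ν univ ^ 2 ≤ mutualEnergy g ν ν := by
  by_cases h0 : ν univ = 0
  · simp [h0]
  have : NeZero ν := ⟨fun h => h0 (by simp [h])⟩
  have h := hJ ((ν univ)⁻¹ • ν) inferInstance
  rw [mutualEnergy_smul_smul _ _ hg] at h
  calc J * ν univ ^ 2 ≤ ((ν univ)⁻¹ ^ 2 * mutualEnergy g ν ν) * ν univ ^ 2 := by gcongr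
    _ = ((ν univ)⁻¹ * ν univ) ^ 2 * mutualEnergy g ν ν := by ring
    _ = mutualEnergy g ν ν := by
      rw [ENNReal.inv_mul_cancel h0 (measure_ne_top _ _)]; simp

lemma mul_measure_mul_measure_le_mutualEnergy_restrict {E : Type*} [NormedAddCommGroup E]
    [MeasurableSpace E] {g : E → ℝ≥0∞} {μ : Measure E} [IsFiniteMeasure μ]
    {c : ℝ≥0∞} {A D : Set E} (hA : MeasurableSet A) (hD : MeasurableSet D)
    (h : ∀ x ∈ A, ∀ y ∈ D, c ≤ g (x - y)) :
    c * (μ A * μ D) ≤ mutualEnergy g (μ.restrict A) (μ.restrict D) := by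
  unfold mutualEnergy
  rw [Measure.prod_restrict, ← Measure.prod_prod, ← setLIntegral_const]
  exact setLIntegral_mono' (hA.prod hD) fun p hp => h _ hp.1 _ hp.2

/-- Splitting a measure into two separated parts: the self-energy of each part is bounded by
homogeneity, and the interaction of the parts by the values of the kernel far away. -/
lemma energy_split_le (hg : Measurable g) {J c : ℝ≥0∞}
    (hJ : ∀ μ : Measure E, IsProbabilityMeasure μ → J ≤ mutualEnergy g μ μ)
    (μ : Measure E) [IsFiniteMeasure μ] {A D : Set E} (hA : MeasurableSet A)
    (hD : MeasurableSet D) (hAD : Disjoint A D)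
    (h : ∀ x ∈ A, ∀ y ∈ D, c ≤ g (x - y)) (h' : ∀ x ∈ D, ∀ y ∈ A, c ≤ g (x - y)) :
    J * μ A ^ 2 + J * μ D ^ 2 + 2 * c * (μ A * μ D) ≤ mutualEnergy g μ μ := by
  have hle : mutualEnergy g (μ.restrict (A ∪ D)) (μ.restrict (A ∪ D)) ≤ mutualEnergy g μ μ := by
    unfold mutualEnergy
    rw [Measure.prod_restrict]
    exact lintegral_mono' Measure.restrict_le_self le_rfl
  refine le_trans ?_ hle
  have hsplit : mutualEnergy g (μ.restrict (A ∪ D)) (μ.restrict (A ∪ D)) =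
      (mutualEnergy g (μ.restrict A) (μ.restrict A) +
        mutualEnergy g (μ.restrict D) (μ.restrict D)) +
      (mutualEnergy g (μ.restrict A) (μ.restrict D) +
        mutualEnergy g (μ.restrict D) (μ.restrict A)) := by
    unfold mutualEnergy
    rw [Measure.restrict_union hAD hD, Measure.prod_add, Measure.add_prod, Measure.add_prod]
    simp only [lintegral_add_measure]
    ring
  rw [hsplit]
  have e1 := mul_sq_measure_univ_le_mutualEnergy hg hJ (μ.restrict A)
  have e2 := mul_sq_measure_univ_le_mutualEnergy hg hJ (μ.restrict D)
  rw [Measure.restrict_apply_univ] at e1 e2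
  have e3 := mul_measure_mul_measure_le_mutualEnergy_restrict (μ := μ) hA hD h
  have e4 := mul_measure_mul_measure_le_mutualEnergy_restrict (μ := μ) hD hA h'
  calc _ = J * μ A ^ 2 + J * μ D ^ 2 + (c * (μ A * μ D) + c * (μ D * μ A)) := by ring
    _ ≤ _ := by gcongr

/-- Vanishing does not occur below the level `c`: some ball carries a mass bounded below in terms
of the energy. -/
lemma exists_measure_ball_ge (hg : Measurable g) {c L : ℝ}
    (hc : 0 < c) (hL : ∀ x, L ≤ ‖x‖ → ENNReal.ofReal c ≤ g x) {e : ℝ} (he : 0 ≤ e)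
    (μ : Measure E) [IsProbabilityMeasure μ] (hμ : mutualEnergy g μ μ ≤ ENNReal.ofReal e) :
    ∃ x, 1 - e / c ≤ μ.real (ball x L) := by
  rw [mutualEnergy_eq_iterated hg] at hμ
  obtain ⟨x, hx⟩ := exists_le_lintegral (μ := μ) (f := fun x => ∫⁻ y, g (x - y) ∂μ)
    (hg.comp measurable_sub).lintegral_prod_right'.aemeasurable
  refine ⟨x, ?_⟩
  have h1 : ENNReal.ofReal c * μ (ball x L)ᶜ ≤ ENNReal.ofReal e := by
    refine le_trans ?_ (hx.trans hμ)
    rw [← setLIntegral_const]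
    refine (setLIntegral_mono' measurableSet_ball.compl fun y hy => ?_).trans
      (setLIntegral_le_lintegral _ _)
    refine hL _ ?_
    rw [mem_compl_iff, mem_ball, not_lt, dist_comm, dist_eq_norm] at hy
    exact hy
  rw [← ofReal_measureReal, ← ENNReal.ofReal_mul hc.le, ENNReal.ofReal_le_ofReal_iff he,
    probReal_compl_eq_one_sub measurableSet_ball] at h1
  have : e / c * c = e := by field_simp
  by_contra! hlt
  nlinarith

/-- Almost-minimizers of the energy are concentrated near any ball that carries a fixed mass, as
soon as the infimum `J` is below the values `c` of the kernel at long range. -/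
lemma exists_measure_compl_ball_le (hg : Measurable g) {J c L m : ℝ} (hJ0 : 0 ≤ J)
    (hJ : ∀ μ : Measure E, IsProbabilityMeasure μ → ENNReal.ofReal J ≤ mutualEnergy g μ μ)
    (hJc : J < c) (hL0 : 0 < L) (hL : ∀ x, L ≤ ‖x‖ → ENNReal.ofReal c ≤ g x) (hm : 0 < m)
    {ε : ℝ} (hε : 0 < ε) :
    ∃ R δ : ℝ, 0 < δ ∧ ∀ μ : Measure E, IsProbabilityMeasure μ → ∀ x,
      mutualEnergy g μ μ ≤ ENNReal.ofReal (J + δ) → m ≤ μ.real (ball x L) →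
        μ.real (ball x R)ᶜ ≤ ε := by
  have hcJ : 0 < c - J := sub_pos.2 hJc
  -- `δ` is the allowed excess energy, and also bounds the cost `2 J / K` of a gap of mass `1 / K`.
  set δ := (c - J) * m * ε
  have hδ0 : 0 < δ := by positivity
  obtain ⟨K, hK⟩ := exists_nat_gt (max (2 * J / δ) 0)
  have hK0 : (0 : ℝ) < K := (le_max_right _ _).trans_lt hK
  have hKJ : 2 * J * (1 / K) ≤ δ := by
    have := (le_max_left _ _).trans_lt hK
    rw [div_lt_iff₀ hδ0] at this
    rw [mul_one_div, div_le_iff₀ hK0]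
    linarith
  refine ⟨L + K * L, δ, hδ0, fun μ hμ x hE hx => ?_⟩
  set φ : ℕ → ℝ := fun j => μ.real (ball x (L + j * L)) with hφ
  -- Among `K` disjoint annuli of width `L`, one has mass at most `1 / K`.
  obtain ⟨j, hjK, hj⟩ : ∃ j < K, φ (j + 1) - φ j ≤ 1 / K := by
    by_contra! hcon
    have h1 : ∑ j ∈ Finset.range K, (1 / K : ℝ) < ∑ j ∈ Finset.range K, (φ (j + 1) - φ j) :=
      Finset.sum_lt_sum_of_nonempty (by simpa using (Nat.cast_pos.1 hK0).ne')
        fun j hj => hcon j (Finset.mem_range.1 hj)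
    rw [Finset.sum_range_sub] at h1
    have h2 : φ K ≤ 1 := measureReal_le_one
    have h3 : 0 ≤ φ 0 := measureReal_nonneg
    simp only [Finset.sum_const, Finset.card_range, nsmul_eq_mul] at h1
    rw [mul_one_div_cancel hK0.ne'] at h1
    linarith
  -- The inner ball and `D`, the outside of that annulus, are at distance at least `L`.
  set D := (ball x (L + ((j + 1 : ℕ) : ℝ) * L))ᶜ with hD
  have hDr : μ.real D = 1 - φ (j + 1) := probReal_compl_eq_one_sub measurableSet_ball
  have hfar : ∀ y ∈ ball x (L + j * L), ∀ z ∈ D, L ≤ dist y z := by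
    intro y hy z hz
    rw [hD, mem_compl_iff, mem_ball, not_lt] at hz
    rw [mem_ball] at hy
    push_cast at hz
    have := dist_triangle z y x
    rw [dist_comm z y] at this
    linarith
  have hsplit := energy_split_le hg hJ μ (A := ball x (L + j * L)) (D := D)
    (c := ENNReal.ofReal c) measurableSet_ball measurableSet_ball.compl
    (Set.disjoint_left.2 fun y hy hy' => by have := hfar y hy y hy'; simp at this; linarith)
    (fun y hy z hz => hL _ (by rw [← dist_eq_norm]; exact hfar y hy z hz))
    (fun y hy z hz => hL _ (by rw [← dist_eq_norm, dist_comm]; exact hfar z hz y hy))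
  have hreal : J * φ j ^ 2 + J * μ.real D ^ 2 + 2 * c * (φ j * μ.real D) ≤ J + δ := by
    rw [← ENNReal.ofReal_le_ofReal_iff (by positivity)]
    refine le_trans (le_of_eq ?_) (hsplit.trans hE)
    have h0 : 0 ≤ φ j := measureReal_nonneg
    have hD0 : 0 ≤ μ.real D := measureReal_nonneg
    have hc0 : 0 ≤ c := hJ0.trans hJc.le
    rw [ENNReal.ofReal_add (by positivity) (by positivity),
      ENNReal.ofReal_add (by positivity) (by positivity), ENNReal.ofReal_mul hJ0,
      ENNReal.ofReal_mul hJ0, ENNReal.ofReal_mul (by positivity), ENNReal.ofReal_mul (by norm_num),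
      ENNReal.ofReal_mul h0, ENNReal.ofReal_pow h0, ENNReal.ofReal_pow hD0, hφ]
    norm_num
  have hsub : μ.real (ball x (L + K * L))ᶜ ≤ μ.real D := by
    refine measureReal_mono (compl_subset_compl.2 (ball_subset_ball ?_))
    have : ((j + 1 : ℕ) : ℝ) ≤ K := by exact_mod_cast hjK
    gcongr
  refine hsub.trans ?_
  have hθ : m ≤ φ j := by
    refine hx.trans (measureReal_mono (ball_subset_ball ?_))
    have : 0 ≤ (j : ℝ) * L := by positivity
    linarith
  have hb0 : 0 ≤ μ.real D := measureReal_nonneg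
  set b := μ.real D
  set s := φ (j + 1) - φ j with hs
  have hsum : φ j + b + s = 1 := by rw [hDr, hs]; ring
  -- With `θ + b + s = 1` the inequality becomes `2 (c - J) θ b ≤ δ + J s (2 - s)`.
  have h1 : 2 * (c - J) * (φ j * b) ≤ δ + 2 * J * s := by
    have h2 : J = J * (φ j + b + s) ^ 2 := by rw [hsum]; ring
    have h3 : (φ j + b + s) ^ 2 =
        φ j ^ 2 + b ^ 2 + 2 * (φ j * b) + 2 * s * (φ j + b + s) - s ^ 2 := by
      ring
    rw [hsum] at h3
    nlinarith [mul_nonneg hJ0 (sq_nonneg s)]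
  have h4 : 2 * J * s ≤ δ := (mul_le_mul_of_nonneg_left hj (by positivity)).trans hKJ
  have h5 : (c - J) * m * b ≤ (c - J) * m * ε := by
    have : (c - J) * (m * b) ≤ (c - J) * (φ j * b) := by gcongr
    linarith
  exact le_of_mul_le_mul_left h5 (by positivity)

end MutualEnergy

/-! ### Lower semicontinuity under weak convergence -/

section WeakConvergence

open Set

/-- Integrals of nonnegative lower semicontinuous functions are lower semicontinuous along weakly
convergent sequences. -/
lemma lintegral_le_liminf_lintegral_of_lowerSemicontinuous {Ω : Type*} [MeasurableSpace Ω]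
    [TopologicalSpace Ω] [OpensMeasurableSpace Ω] [HasOuterApproxClosed Ω]
    {μ : ProbabilityMeasure Ω} {μs : ℕ → ProbabilityMeasure Ω}
    (hμ : Tendsto μs atTop (𝓝 μ)) {f : Ω → ℝ≥0∞} (hf : LowerSemicontinuous f) :
    ∫⁻ x, f x ∂(μ : Measure Ω) ≤ atTop.liminf fun n => ∫⁻ x, f x ∂(μs n : Measure Ω) := by
  have hfm : Measurable f := hf.measurable
  -- The layer-cake formula is for real functions, hence the truncation at height `k`.
  have htrunc (k : ℕ) : ∫⁻ x, min (f x) k ∂(μ : Measure Ω) ≤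
      atTop.liminf fun n => ∫⁻ x, f x ∂(μs n : Measure Ω) := by
    set h : Ω → ℝ := fun x => (min (f x) k).toReal
    have hfin (x) : min (f x) k ≠ ⊤ := ((min_le_right _ _).trans_lt (by simp)).ne
    have hh (x) : min (f x) k = ENNReal.ofReal (h x) := (ENNReal.ofReal_toReal (hfin x)).symm
    have hmeas : Measurable h := (hfm.min measurable_const).ennreal_toReal
    have hnn : 0 ≤ h := fun x => ENNReal.toReal_nonneg
    have hopen {t : ℝ} (ht : 0 < t) : IsOpen {x | t < h x} := by
      have : {x | t < h x} = {x | ENNReal.ofReal t < f x} ∩ {_x | ENNReal.ofReal t < k} := by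
        ext x
        simp only [mem_ofPred_eq, mem_inter_iff, ← lt_min_iff]
        exact (ENNReal.ofReal_lt_iff_lt_toReal ht.le (hfin x)).symm
      rw [this]
      exact (hf.isOpen_preimage _).inter isOpen_const
    calc ∫⁻ x, min (f x) k ∂(μ : Measure Ω)
        = ∫⁻ t in Ioi (0 : ℝ), (μ : Measure Ω) {x | t < h x} := by
          simp_rw [hh]
          exact lintegral_eq_lintegral_meas_lt _ (Eventually.of_forall hnn) hmeas.aemeasurable
      _ ≤ ∫⁻ t in Ioi (0 : ℝ), atTop.liminf fun n => (μs n : Measure Ω) {x | t < h x} :=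
          setLIntegral_mono' measurableSet_Ioi fun t ht =>
            ProbabilityMeasure.le_liminf_measure_open_of_tendsto hμ (hopen ht)
      _ ≤ atTop.liminf fun n => ∫⁻ t in Ioi (0 : ℝ), (μs n : Measure Ω) {x | t < h x} :=
          lintegral_liminf_le fun n => Antitone.measurable fun s t hst =>
            measure_mono fun ω hω => lt_of_le_of_lt hst hω
      _ = atTop.liminf fun n => ∫⁻ x, min (f x) k ∂(μs n : Measure Ω) := by
          simp_rw [hh]
          congr! 2 with n
          exact (lintegral_eq_lintegral_meas_lt _ (Eventually.of_forall hnn)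
            hmeas.aemeasurable).symm
      _ ≤ atTop.liminf fun n => ∫⁻ x, f x ∂(μs n : Measure Ω) :=
          liminf_le_liminf (Eventually.of_forall fun n => lintegral_mono fun x => min_le_left _ _)
  have hsup (x) : f x = ⨆ k : ℕ, min (f x) k := by
    rw [← inf_iSup_eq, ENNReal.iSup_natCast, inf_top_eq]
  calc ∫⁻ x, f x ∂(μ : Measure Ω) = ∫⁻ x, ⨆ k : ℕ, min (f x) k ∂(μ : Measure Ω) := by
        simp_rw [← hsup]
    _ = ⨆ k : ℕ, ∫⁻ x, min (f x) k ∂(μ : Measure Ω) :=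
        lintegral_iSup (fun k => hfm.min measurable_const)
          fun i j hij x => min_le_min le_rfl (by exact_mod_cast hij)
    _ ≤ _ := iSup_le htrunc

end WeakConvergence

/-! ### Minimizers and spreading of mass -/

section Minimizer

open Metric Set

variable {E : Type*} [NormedAddCommGroup E] [MeasurableSpace E] [BorelSpace E] [ProperSpace E]
  {g : E → ℝ≥0∞}

lemma mutualEnergy_le_liminf (hg : LowerSemicontinuous g) {μ : ProbabilityMeasure E}
    {μs : ℕ → ProbabilityMeasure E} (hμ : Tendsto μs atTop (𝓝 μ)) :
    mutualEnergy g μ μ ≤ atTop.liminf fun n => mutualEnergy g (μs n : Measure E) (μs n) := by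
  have hprod : Tendsto (fun n => (μs n).prod (μs n)) atTop (𝓝 (μ.prod μ)) :=
    (ProbabilityMeasure.continuous_prod.tendsto (μ, μ)).comp (hμ.prodMk_nhds hμ)
  exact lintegral_le_liminf_lintegral_of_lowerSemicontinuous hprod
    (hg.comp (continuous_fst.sub continuous_snd))

lemma exists_forall_norm_ge_of_tendsto_cocompact {E : Type*} [NormedAddCommGroup E]
    [ProperSpace E] {g : E → ℝ≥0∞} {p : ℝ≥0∞ → Prop} {M : ℝ≥0∞}
    (hgM : Tendsto g (cocompact E) (𝓝 M)) (hp : ∀ᶠ t in 𝓝 M, p t) :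
    ∃ L : ℝ, 0 < L ∧ ∀ x, L ≤ ‖x‖ → p (g x) := by
  have h := hgM.eventually hp
  rw [← cobounded_eq_cocompact, ← comap_norm_atTop, eventually_comap] at h
  obtain ⟨L, hL⟩ := eventually_atTop.1 h
  exact ⟨max L 1, by positivity, fun x hx => hL _ ((le_max_left _ _).trans hx) x rfl⟩

/-- A lower semicontinuous kernel with limit `M` at infinity whose energy is somewhere below `M`
has a minimizer: a minimizing sequence is tight after translations. -/
lemma exists_minimizer_mutualEnergy (hg : LowerSemicontinuous g) {M : ℝ≥0∞}
    (hgM : Tendsto g (cocompact E) (𝓝 M))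
    (hlt : ∃ μ : ProbabilityMeasure E, mutualEnergy g μ μ < M) :
    ∃ μ₀ : ProbabilityMeasure E, ∀ μ : ProbabilityMeasure E,
      mutualEnergy g μ₀ μ₀ ≤ mutualEnergy g μ μ := by
  have hgm : Measurable g := hg.measurable
  set J : ℝ≥0∞ := ⨅ μ : ProbabilityMeasure E, mutualEnergy g μ μ with hJdef
  have hJM : J < M := iInf_lt_iff.2 hlt
  obtain ⟨e, hJe, heM⟩ := exists_between hJM
  obtain ⟨c, hec, hcM⟩ := exists_between heM
  lift J to ℝ≥0 using hJe.ne_top with j hj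
  lift e to ℝ≥0 using hec.ne_top
  lift c to ℝ≥0 using hcM.ne_top
  have hJle (μ : Measure E) (hμ : IsProbabilityMeasure μ) :
      ENNReal.ofReal j ≤ mutualEnergy g μ μ := by
    rw [ENNReal.ofReal_coe_nnreal, hj]
    exact iInf_le _ (⟨μ, hμ⟩ : ProbabilityMeasure E)
  have hje : j < e := by exact_mod_cast hJe
  have hec' : e < c := by exact_mod_cast hec
  obtain ⟨L, hL0, hL⟩ := exists_forall_norm_ge_of_tendsto_cocompact hgM
    ((lt_mem_nhds hcM).mono fun _ => le_of_lt)
  replace hL : ∀ x, L ≤ ‖x‖ → ENNReal.ofReal (c : ℝ) ≤ g x := by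
    simpa only [ENNReal.ofReal_coe_nnreal] using hL
  have hc0 : (0 : ℝ) < c := by exact_mod_cast (zero_le.trans_lt hec')
  set m : ℝ := 1 - e / c
  have hm : 0 < m := by
    have : (e : ℝ) / c < 1 := (div_lt_one hc0).2 (by exact_mod_cast hec')
    simp only [m]; linarith
  -- A minimizing sequence, normalized so that the ball of radius `L` at the origin has mass `≥ m`.
  have hseq (n : ℕ) : ∃ ν : ProbabilityMeasure E,
      mutualEnergy g ν ν ≤ ENNReal.ofReal (j + 1 / (n + 1)) ∧
        m ≤ (ν : Measure E).real (ball 0 L) := by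
    have hlt' : (j : ℝ≥0∞) < min (e : ℝ≥0∞) (ENNReal.ofReal (j + 1 / (n + 1))) := by
      refine lt_min hJe ?_
      rw [← ENNReal.ofReal_coe_nnreal]
      exact (ENNReal.ofReal_lt_ofReal_iff (by positivity)).2 (lt_add_of_pos_right _ (by positivity))
    rw [hj] at hlt'
    obtain ⟨μ, hμ⟩ := iInf_lt_iff.1 hlt'
    obtain ⟨x, hx⟩ := exists_measure_ball_ge hgm hc0 hL e.2 (μ : Measure E)
      (by
        rw [NNReal.val_eq_coe, ENNReal.ofReal_coe_nnreal]
        exact (hμ.trans_le (min_le_left _ _)).le)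
    have hsub : Measurable (fun y : E => y - x) := measurable_id.sub_const x
    refine ⟨μ.map hsub.aemeasurable, ?_, ?_⟩
    · rw [ProbabilityMeasure.toMeasure_map, mutualEnergy_map_sub_const hgm]
      exact (hμ.trans_le (min_le_right _ _)).le
    · rw [ProbabilityMeasure.toMeasure_map, map_measureReal_apply hsub measurableSet_ball]
      refine hx.trans_eq (congrArg _ ?_)
      ext y
      simp [dist_eq_norm]
  choose ν hνE hνm using hseq
  have htight : IsTightMeasureSet (range fun n => (ν n : Measure E)) := by
    refine isTightMeasureSet_range_of_tendsto_limsup_measure_norm_gt ?_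
    rw [ENNReal.tendsto_atTop_zero]
    intro ε hε
    obtain ⟨η, hη0, hηε⟩ := ENNReal.lt_iff_exists_nnreal_btwn.1 hε
    obtain ⟨R, δ, hδ, hR⟩ := exists_measure_compl_ball_le hgm j.2 hJle
      (by exact_mod_cast hje.trans hec' : (j : ℝ) < c) hL0 hL hm
      (ε := η) (by exact_mod_cast hη0)
    refine ⟨R, fun r hr => limsup_le_of_le (by isBoundedDefault) ?_⟩
    have hev : ∀ᶠ n : ℕ in atTop, (1 : ℝ) / (n + 1) ≤ δ :=
      (tendsto_one_div_add_atTop_nhds_zero_nat.eventually_lt_const hδ).mono fun _ => le_of_lt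
    filter_upwards [hev] with n hn
    have h := hR (ν n) inferInstance 0
      ((hνE n).trans (ENNReal.ofReal_le_ofReal (by gcongr; rfl))) (hνm n)
    calc (ν n : Measure E) {x | r < ‖x‖} ≤ (ν n : Measure E) (ball 0 R)ᶜ :=
          measure_mono fun x hx => by
            simp only [mem_ofPred_eq] at hx
            simpa using hr.trans hx.le
      _ = ENNReal.ofReal ((ν n : Measure E).real (ball 0 R)ᶜ) :=
          (ofReal_measureReal (measure_ne_top _ _)).symm
      _ ≤ ENNReal.ofReal η := ENNReal.ofReal_le_ofReal h
      _ ≤ ε := by rw [ENNReal.ofReal_coe_nnreal]; exact hηε.le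
  have hcomp : IsCompact (closure (range ν)) := by
    refine isCompact_closure_of_isTightMeasureSet ?_
    convert htight using 1
    ext μ
    simp
  obtain ⟨μ₀, -, φ, hφ, hlim⟩ := hcomp.tendsto_subseq fun n => subset_closure (mem_range_self n)
  refine ⟨μ₀, fun μ => ?_⟩
  have hbound : Tendsto (fun n : ℕ => ENNReal.ofReal (j + 1 / ((φ n : ℝ) + 1))) atTop
      (𝓝 (ENNReal.ofReal (j + 0))) :=
    ENNReal.tendsto_ofReal
      ((tendsto_one_div_add_atTop_nhds_zero_nat.comp hφ.tendsto_atTop).const_add _)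
  calc mutualEnergy g μ₀ μ₀
      ≤ atTop.liminf fun n => mutualEnergy g (ν (φ n) : Measure E) (ν (φ n)) :=
        mutualEnergy_le_liminf hg hlim
    _ ≤ atTop.liminf fun n : ℕ => ENNReal.ofReal (j + 1 / ((φ n : ℝ) + 1)) :=
        liminf_le_liminf (Eventually.of_forall fun n => hνE (φ n))
    _ = ENNReal.ofReal j := by rw [hbound.liminf_eq, add_zero]
    _ ≤ mutualEnergy g μ μ := hJle μ inferInstance

/-- Spreading mass uniformly over large balls brings the energy down to the limit of the kernel at
infinity. -/
lemma exists_mutualEnergy_le_of_tendsto_cocompact [NormedSpace ℝ E] [Nontrivial E]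
    (lam : Measure E) [lam.IsAddHaarMeasure] (hg : Measurable g) {M : ℝ≥0∞}
    (hgM : Tendsto g (cocompact E) (𝓝 M)) (hint : ∀ r : ℝ, ∫⁻ x in ball 0 r, g x ∂lam ≠ ⊤)
    {c : ℝ≥0∞} (hMc : M < c) :
    ∃ μ : ProbabilityMeasure E, mutualEnergy g μ μ ≤ c := by
  have : NoncompactSpace E := NormedSpace.noncompactSpace ℝ E
  -- `g ≤ a` far away, and the mass `C` of `g` near `0` is diluted by the volume to at most `b - a`.
  obtain ⟨b, hMb, hbc⟩ := exists_between hMc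
  obtain ⟨a, hMa, hab⟩ := exists_between hMb
  obtain ⟨r, -, hr⟩ := exists_forall_norm_ge_of_tendsto_cocompact hgM
    ((gt_mem_nhds hMa).mono fun _ => le_of_lt)
  set C := ∫⁻ x in ball 0 r, g x ∂lam
  have hba0 : b - a ≠ 0 := (tsub_pos_of_lt hab).ne'
  have hbat : b - a ≠ ⊤ := (tsub_le_self.trans_lt hbc.lt_top).ne
  have hvol : Tendsto (fun n : ℕ => lam (ball 0 n)) atTop (𝓝 ⊤) := by
    rw [← measure_univ_of_isAddLeftInvariant lam, ← iUnion_ball_nat (0 : E)]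
    exact tendsto_measure_iUnion_atTop fun i j hij => ball_subset_ball (by exact_mod_cast hij)
  obtain ⟨n, hn, hn0⟩ := ((hvol.eventually (lt_mem_nhds
    (ENNReal.div_lt_top (hint r) hba0))).and
      (hvol.eventually (lt_mem_nhds ENNReal.zero_lt_top))).exists
  set B : Set E := ball 0 (n : ℝ)
  have hBt : lam B ≠ ⊤ := measure_ball_lt_top.ne
  have : IsProbabilityMeasure ((lam B)⁻¹ • lam.restrict B) :=
    ⟨by simp [ENNReal.inv_mul_cancel hn0.ne' hBt]⟩
  have hCV : C ≤ (b - a) * lam B := by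
    have := (ENNReal.div_le_iff hba0 hbat).1 hn.le
    rwa [mul_comm]
  have hinner (x : E) : ∫⁻ y in B, g (x - y) ∂lam ≤ b * lam B := by
    calc ∫⁻ y in B, g (x - y) ∂lam
        ≤ ∫⁻ y in B, ((ball 0 r).indicator g (x - y) + a) ∂lam := by
          refine lintegral_mono fun y => ?_
          by_cases hy : x - y ∈ ball 0 r
          · simp [indicator_of_mem hy]
          · rw [indicator_of_notMem hy, zero_add]
            exact hr _ (by simpa using hy)
      _ = ∫⁻ y in B, (ball 0 r).indicator g (x - y) ∂lam + a * lam B := by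
          rw [lintegral_add_right _ measurable_const, setLIntegral_const]
      _ ≤ ∫⁻ y, (ball 0 r).indicator g (x - y) ∂lam + a * lam B := by
          exact add_le_add_left (setLIntegral_le_lintegral _ _) _
      _ = C + a * lam B := by
          rw [lintegral_sub_left_eq_self, lintegral_indicator measurableSet_ball]
      _ ≤ (b - a) * lam B + a * lam B := by gcongr
      _ = b * lam B := by rw [← add_mul, tsub_add_cancel_of_le hab.le]
  refine ⟨⟨(lam B)⁻¹ • lam.restrict B, this⟩, ?_⟩
  rw [ProbabilityMeasure.coe_mk, mutualEnergy_eq_iterated hg]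
  refine (lintegral_mono (g := fun _ => b) fun x => ?_).trans ?_
  · rw [lintegral_smul_measure, smul_eq_mul]
    calc (lam B)⁻¹ * ∫⁻ y in B, g (x - y) ∂lam ≤ (lam B)⁻¹ * (b * lam B) := by
          gcongr; exact hinner x
      _ = b * ((lam B)⁻¹ * lam B) := by ring
      _ = b := by rw [ENNReal.inv_mul_cancel hn0.ne' hBt, mul_one]
  · rw [lintegral_const, measure_univ, mul_one]
    exact hbc.le

end Minimizer

/-! ### Extended-real integrals of functions bounded below -/

section ERealIntegral

lemma EReal.toENNReal_add_coe_eq {t : EReal} {M : ℝ≥0} (ht : ((-M : ℝ) : EReal) ≤ t) :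
    t.toENNReal + M = (t + (M : ℝ)).toENNReal + (-t).toENNReal := by
  induction t with
  | bot => simp at ht
  | top => simp
  | coe r =>
    have hr : -(M : ℝ) ≤ r := EReal.coe_le_coe_iff.1 ht
    rw [← EReal.coe_add, ← EReal.coe_neg]
    simp only [EReal.real_coe_toENNReal]
    rw [← ENNReal.ofReal_coe_nnreal]
    rcases le_total 0 r with h | h
    · rw [ENNReal.ofReal_of_nonpos (p := -r) (by linarith), add_zero,
        ENNReal.ofReal_add h M.coe_nonneg]
    · rw [ENNReal.ofReal_of_nonpos h, zero_add,
        ← ENNReal.ofReal_add (by linarith) (by linarith)]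
      congr 1
      ring

/-- Adding a constant to an integrand that is bounded below reduces its extended-real integral to
a Lebesgue integral of a nonnegative function. -/
lemma erealIntegral_eq_lintegral_sub {α : Type*} [MeasurableSpace α] {f : α → EReal}
    (hf : Measurable f) {M : ℝ≥0} (hM : ∀ x, ((-M : ℝ) : EReal) ≤ f x) (μ : Measure α)
    [IsProbabilityMeasure μ] :
    erealIntegral f μ = ((∫⁻ x, (f x + (M : ℝ)).toENNReal ∂μ : ℝ≥0∞) : EReal) - (M : ℝ) := by
  unfold erealIntegral
  have hneg : Measurable fun x => (-f x).toENNReal := hf.neg.ereal_toENNReal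
  set P := ∫⁻ x, (f x).toENNReal ∂μ
  set B := ∫⁻ x, (-f x).toENNReal ∂μ with hB
  set F := ∫⁻ x, (f x + (M : ℝ)).toENNReal ∂μ
  have hsum : P + M = F + B := by
    have h := lintegral_congr (μ := μ) fun x => EReal.toENNReal_add_coe_eq (hM x)
    rwa [lintegral_add_right _ measurable_const, lintegral_add_right _ hneg, lintegral_const,
      measure_univ, mul_one] at h
  have hBM : B ≤ M := by
    calc B ≤ ∫⁻ _, (M : ℝ≥0∞) ∂μ := by
          refine lintegral_mono fun x => ?_
          have h : -f x ≤ ((M : ℝ) : EReal) := by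
            rw [EReal.neg_le]
            exact hM x
          refine (EReal.toENNReal_le_toENNReal h).trans ?_
          simp
      _ = M := by simp
  have hBt : B ≠ ⊤ := (hBM.trans_lt ENNReal.coe_lt_top).ne
  clear_value P B F
  lift B to ℝ≥0 using hBt
  by_cases hF : F = ⊤
  · have hP : P = ⊤ := by
      rw [hF, top_add] at hsum
      exact (ENNReal.add_eq_top.1 hsum).resolve_right ENNReal.coe_ne_top
    rw [hF, hP]
    rfl
  · have hP : P ≠ ⊤ := fun h => by
      rw [h, top_add] at hsum
      exact ENNReal.add_ne_top.2 ⟨hF, ENNReal.coe_ne_top⟩ hsum.symm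
    lift F to ℝ≥0 using hF
    lift P to ℝ≥0 using hP
    have h : (P : ℝ) + M = F + B := by exact_mod_cast hsum
    change (((P : ℝ)) : EReal) - ((B : ℝ) : EReal) = ((F : ℝ) : EReal) - ((M : ℝ) : EReal)
    rw [← EReal.coe_sub, ← EReal.coe_sub]
    congr 1
    linarith

end ERealIntegral

/-! ### The shifted potential -/

section ShiftedPotential

/-- The profile is bounded below: by compactness on bounded intervals, by its limit elsewhere. -/
lemma exists_forall_neg_le_of_lowerSemicontinuous {W : ℝ≥0 → EReal} (hW : ∀ r, W r ≠ ⊥)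
    (hlsc : LowerSemicontinuous W) (hlim : Tendsto W atTop (𝓝 0)) :
    ∃ M : ℝ≥0, ∀ r, ((-M : ℝ) : EReal) ≤ W r := by
  have hev : ∀ᶠ r in atTop, ((-1 : ℝ) : EReal) < W r :=
    hlim.eventually (lt_mem_nhds (by rw [← EReal.coe_zero, EReal.coe_lt_coe_iff]; norm_num))
  obtain ⟨L, hL⟩ := eventually_atTop.1 hev
  obtain ⟨r₀, -, hr₀⟩ := LowerSemicontinuousOn.exists_isMinOn (s := Set.Icc 0 L)
    ⟨0, by simp⟩ isCompact_Icc (hlsc.lowerSemicontinuousOn _)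
  obtain ⟨a, ha⟩ : ∃ a : ℝ, (a : EReal) ≤ W r₀ :=
    ((EReal.lt_iff_exists_real_btwn).1 (bot_lt_iff_ne_bot.2 (hW r₀))).imp fun _ h => h.2.le
  refine ⟨(max (-a) 1).toNNReal, fun r => ?_⟩
  rw [Real.coe_toNNReal _ (by positivity)]
  rcases le_total L r with h | h
  · refine le_trans (EReal.coe_le_coe_iff.2 ?_) (hL r h).le
    linarith [le_max_right (-a) 1]
  · refine le_trans (EReal.coe_le_coe_iff.2 ?_) (ha.trans (hr₀ ⟨zero_le, h⟩))
    linarith [le_max_left (-a) 1]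

lemma EReal.continuous_add_coe (a : ℝ) : Continuous fun t : EReal => t + a :=
  continuous_iff_continuousAt.2 fun t =>
    (EReal.continuousAt_add (p := (t, (a : EReal))) (by simp) (by simp)).comp
      (f := fun t : EReal => (t, (a : EReal))) (by fun_prop)

variable {N : ℕ}

/-- The nonnegative kernel `w + M` on `ℝ^N`; nothing is lost in the truncation at `0` when `w` is
bounded below by `-M`. -/
noncomputable def shiftedPotential (W : ℝ≥0 → EReal) (M : ℝ≥0) (x : EuclideanSpace ℝ (Fin N)) :
    ℝ≥0∞ :=
  (radialPotential W x + (M : ℝ)).toENNReal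

lemma lowerSemicontinuous_radialPotential {W : ℝ≥0 → EReal} (hW : LowerSemicontinuous W) :
    LowerSemicontinuous (radialPotential W : EuclideanSpace ℝ (Fin N) → EReal) :=
  hW.comp continuous_nnnorm

lemma lowerSemicontinuous_shiftedPotential {W : ℝ≥0 → EReal} (hW : LowerSemicontinuous W)
    (M : ℝ≥0) :
    LowerSemicontinuous (shiftedPotential W M : EuclideanSpace ℝ (Fin N) → ℝ≥0∞) :=
  (EReal.continuous_toENNReal.comp (EReal.continuous_add_coe M)).comp_lowerSemicontinuous
    (lowerSemicontinuous_radialPotential hW)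
    fun _ _ h => EReal.toENNReal_le_toENNReal (add_le_add_left h _)

lemma tendsto_shiftedPotential {W : ℝ≥0 → EReal} (hW : Tendsto W atTop (𝓝 0)) (M : ℝ≥0) :
    Tendsto (shiftedPotential W M : EuclideanSpace ℝ (Fin N) → ℝ≥0∞) (cocompact _) (𝓝 M) := by
  have hnorm : Tendsto (fun x : EuclideanSpace ℝ (Fin N) => ‖x‖₊) (cocompact _) atTop := by
    rw [← NNReal.tendsto_coe_atTop]
    exact tendsto_norm_cocompact_atTop (E := EuclideanSpace ℝ (Fin N))
  have h := ((EReal.continuous_toENNReal.comp (EReal.continuous_add_coe M)).tendsto 0).comp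
    (hW.comp hnorm)
  simp only [Function.comp_apply, zero_add, EReal.real_coe_toENNReal,
    ENNReal.ofReal_coe_nnreal] at h
  exact h

lemma interactionEnergy_eq_mutualEnergy_sub {W : ℝ≥0 → EReal} (hW : LowerSemicontinuous W)
    {M : ℝ≥0} (hM : ∀ r, ((-M : ℝ) : EReal) ≤ W r)
    (μ : ProbabilityMeasure (EuclideanSpace ℝ (Fin N))) :
    interactionEnergy W μ =
      (mutualEnergy (shiftedPotential W M) (μ : Measure (EuclideanSpace ℝ (Fin N))) μ : EReal)
        - (M : ℝ) :=
  erealIntegral_eq_lintegral_sub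
    ((lowerSemicontinuous_radialPotential hW).measurable.comp measurable_sub) (fun _ => hM _) _

lemma setLIntegral_ball_shiftedPotential_ne_top {W : ℝ≥0 → EReal}
    (hint : ERealLocallyIntegrable (radialPotential W : EuclideanSpace ℝ (Fin N) → EReal))
    (M : ℝ≥0) (r : ℝ) :
    ∫⁻ x in Metric.ball (0 : EuclideanSpace ℝ (Fin N)) r, shiftedPotential W M x ≠ ⊤ := by
  have hI : IntegrableOn (fun x : EuclideanSpace ℝ (Fin N) => (radialPotential W x).toReal)
      (Metric.ball 0 r) :=
    (hint.2.integrableOn_isCompact (isCompact_closedBall 0 r)).mono_set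
      Metric.ball_subset_closedBall
  refine ne_top_of_le_ne_top
    (b := ∫⁻ x in Metric.ball (0 : EuclideanSpace ℝ (Fin N)) r,
      (‖(radialPotential W x).toReal‖ₑ + M)) ?_ (lintegral_mono_ae ?_)
  · rw [lintegral_add_right _ measurable_const, setLIntegral_const]
    exact ENNReal.add_ne_top.2
      ⟨hI.2.ne, ENNReal.mul_ne_top ENNReal.coe_ne_top measure_ball_lt_top.ne⟩
  · filter_upwards [ae_restrict_of_ae hint.1] with x hx
    refine EReal.toENNReal_add_le.trans (add_le_add ?_ (by simp))
    rw [EReal.toENNReal_of_ne_top hx.1]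
    exact Real.ofReal_le_enorm _

end ShiftedPotential

/-! ### Existence of global minimizers -/

theorem theorem3p2 (N : ℕ) (hN : 1 ≤ N) (W : ℝ≥0 → EReal)
    (hW : ∀ r, W r ≠ ⊥)
    (hW_lsc : LowerSemicontinuous W)
    (hW_int : ERealLocallyIntegrable
      (radialPotential W : EuclideanSpace ℝ (Fin N) → EReal))
    (hW_lim : Tendsto W atTop (𝓝 0)) :
    (∃ μ₀ : ProbabilityMeasure (EuclideanSpace ℝ (Fin N)),
        ∀ μ : ProbabilityMeasure (EuclideanSpace ℝ (Fin N)),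
          interactionEnergy W μ₀ ≤ interactionEnergy W μ) ↔
      ∃ μ : ProbabilityMeasure (EuclideanSpace ℝ (Fin N)), interactionEnergy W μ ≤ 0 := by
  obtain ⟨M, hM⟩ := exists_forall_neg_le_of_lowerSemicontinuous hW hW_lsc hW_lim
  have hglsc : LowerSemicontinuous (shiftedPotential W M : EuclideanSpace ℝ (Fin N) → ℝ≥0∞) :=
    lowerSemicontinuous_shiftedPotential hW_lsc M
  have hglim := tendsto_shiftedPotential (N := N) hW_lim M
  have hle (μ ν : ProbabilityMeasure (EuclideanSpace ℝ (Fin N))) :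
      interactionEnergy W μ ≤ interactionEnergy W ν ↔
        mutualEnergy (shiftedPotential W M) (μ : Measure (EuclideanSpace ℝ (Fin N))) μ ≤
          mutualEnergy (shiftedPotential W M) (ν : Measure (EuclideanSpace ℝ (Fin N))) ν := by
    rw [interactionEnergy_eq_mutualEnergy_sub hW_lsc hM,
      interactionEnergy_eq_mutualEnergy_sub hW_lsc hM,
      EReal.sub_le_iff_le_add (by simp) (by simp), EReal.sub_add_cancel,
      EReal.coe_ennreal_le_coe_ennreal_iff]
  have hle0 (μ : ProbabilityMeasure (EuclideanSpace ℝ (Fin N))) :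
      interactionEnergy W μ ≤ 0 ↔
        mutualEnergy (shiftedPotential W M) (μ : Measure (EuclideanSpace ℝ (Fin N))) μ ≤ M := by
    rw [interactionEnergy_eq_mutualEnergy_sub hW_lsc hM,
      EReal.sub_le_iff_le_add (by simp) (by simp), zero_add,
      ← EReal.coe_ennreal_le_coe_ennreal_iff]
    rfl
  simp only [hle, hle0]
  constructor
  · rintro ⟨μ₀, hμ₀⟩
    have : Nonempty (Fin N) := ⟨⟨0, hN⟩⟩
    refine ⟨μ₀, le_of_forall_gt_imp_ge_of_dense fun c hc => ?_⟩
    obtain ⟨μ, hμ⟩ := exists_mutualEnergy_le_of_tendsto_cocompact volume hglsc.measurable hglim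
      (setLIntegral_ball_shiftedPotential_ne_top hW_int M) hc
    exact (hμ₀ μ).trans hμ
  · rintro ⟨μ₁, hμ₁⟩
    -- If no energy is negative, then `μ₁` itself is a minimizer.
    by_cases hlt : ∃ μ : ProbabilityMeasure (EuclideanSpace ℝ (Fin N)),
        mutualEnergy (shiftedPotential W M) (μ : Measure (EuclideanSpace ℝ (Fin N))) μ < M
    · exact exists_minimizer_mutualEnergy hglsc hglim hlt
    · push Not at hlt
      exact ⟨μ₁, fun μ => hμ₁.trans (hlt μ)⟩
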